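/- For a real Banach space $X$ with closed unit ball $B_X$, the following three properties are equivalent. (a) $X$ is nonreflexive, i.e. the canonical embedding $X\to X^{**}$ is not surjective. (b) There is a continuous convex function $f\colon X\to(0,\infty)$ such that $1/f$ is not representable as a difference of two continuous convex real-valued functions on $X$. (c) There is a decreasing sequence $C_1\supseteq C_2\supseteq\cdots$ of bounded closed convex subsets of $X$ such that $$\bigcap_{n=1}^{\infty} C_n=\emptyset \quad\text{and}\quad \bigcap_{n=1}^{\infty}\,(C_n+\varepsilon B_X)\neq\emptyset \ \text{ for every } \varepsilon>0.$$ -/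

import Mathlib

open scoped Pointwise

/-- A real normed space is reflexive if the canonical embedding into its bidual is onto. -/
def IsReflexiveSpace (X : Type*) [NormedAddCommGroup X] [NormedSpace ℝ X] : Prop :=
  Function.Surjective (NormedSpace.inclusionInDoubleDual ℝ X)

/-- A d.c. function: a difference of two continuous convex real functions on the whole space. -/
def IsDCFunction {X : Type*} [NormedAddCommGroup X] [NormedSpace ℝ X] (h : X → ℝ) : Prop :=
  ∃ g₁ g₂ : X → ℝ,
    Continuous g₁ ∧ ConvexOn ℝ Set.univ g₁ ∧
    Continuous g₂ ∧ ConvexOn ℝ Set.univ g₂ ∧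
    ∀ x, h x = g₁ x - g₂ x

open Filter Topology Metric NormedSpace

/-! ### Weak compactness in reflexive spaces -/

section Reflexive

variable {X : Type*} [NormedAddCommGroup X] [NormedSpace ℝ X]

/-! If `X` is nonreflexive, some `F` in the bidual has positive distance from `X`; this yields
bounded `x k`, `g n` with `g n (x k)` at least `θ` for `n ≤ k` and zero for `k < n`. Let `C n` be
the closed convex hull of all `x j + x k / (j + 1)` with `k ≥ n` and `j` arbitrary: `x j` is
uniformly close to every `C n`, while the `g n` rule out a common point. Given such `C n`, put `f =
sup dist(·, C n) / (n + 1)`. A d.c. `1 / f` would lie below a continuous convex function, which is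
bounded on all balls of one fixed radius; but some such ball meets every `C n`, and `f` is at most
of order `1 / n` on `C n`. If `X` is reflexive, weak compactness keeps a positive continuous convex
`f` away from zero on balls, so `1 / f ^ 2` has a continuous convex majorant `k`, and `1 / f + (f +
k) ^ 2` is convex. -/

theorem IsReflexiveSpace.isCompact_closure_toWeakSpace (hX : IsReflexiveSpace X)
    {S : Set X} (hS : Bornology.IsBounded S) :
    IsCompact (closure (toWeakSpace ℝ X '' S)) := by
  refine isCompact_closure_of_isBounded ℝ X _ ?_ fun F _ => ?_
  · rwa [Set.preimage_image_eq _ (toWeakSpace ℝ X).injective]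
  · obtain ⟨x, hx⟩ := hX (WeakDual.toStrongDual F)
    exact ⟨toWeakSpace ℝ X x, hx⟩

/-- In a reflexive space, a decreasing sequence of nonempty bounded closed convex sets has a
common point. -/
theorem IsReflexiveSpace.nonempty_iInter (hX : IsReflexiveSpace X) {C : ℕ → Set X}
    (hanti : Antitone C) (hne : ∀ n, (C n).Nonempty)
    (hbdd : ∀ n, Bornology.IsBounded (C n)) (hclosed : ∀ n, IsClosed (C n))
    (hconv : ∀ n, Convex ℝ (C n)) : (⋂ n, C n).Nonempty := by
  have hcl : ∀ n, IsClosed (toWeakSpace ℝ X '' C n) := fun n => by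
    rw [← (hclosed n).closure_eq, (hconv n).toWeakSpace_closure ℝ]
    exact isClosed_closure
  obtain ⟨y, hy⟩ := IsCompact.nonempty_iInter_of_sequence_nonempty_isCompact_isClosed
    (fun n => toWeakSpace ℝ X '' C n) (fun n => Set.image_mono (hanti n.le_succ))
    (fun n => (hne n).image _)
    (by simpa only [(hcl 0).closure_eq] using hX.isCompact_closure_toWeakSpace (hbdd 0)) hcl
  rw [← Set.image_iInter (toWeakSpace ℝ X).bijective] at hy
  obtain ⟨x, hx, -⟩ := hy
  exact ⟨x, hx⟩

end Reflexive

/-! ### Goldstine and Helly arguments; triangular sequences -/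

section Bidual

variable {X : Type*} [NormedAddCommGroup X] [NormedSpace ℝ X]

/-- A quantitative form of Goldstine's theorem, for finitely many functionals. -/
theorem exists_norm_le_forall_abs_sub_lt {ι : Type*} [Fintype ι]
    (F : StrongDual ℝ (StrongDual ℝ X)) (g : ι → StrongDual ℝ X) {ε : ℝ} (hε : 0 < ε) :
    ∃ x : X, ‖x‖ ≤ ‖F‖ + 1 ∧ ∀ i, |g i x - F (g i)| < ε := by
  classical
  -- The slack `+ 1` makes `‖F‖ * (u / R) < u` strict, contradicting the separation.
  set R : ℝ := ‖F‖ + 1 with hR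
  have hR0 : 0 < R := by positivity
  let T : X →L[ℝ] (ι → ℝ) := ContinuousLinearMap.pi g
  let v : ι → ℝ := fun i => F (g i)
  by_cases hv : v ∈ closure (T '' closedBall 0 R)
  · obtain ⟨_, ⟨x, hx, rfl⟩, hxv⟩ := Metric.mem_closure_iff.1 hv ε hε
    refine ⟨x, by simpa using hx, fun i => ?_⟩
    have := (dist_pi_lt_iff hε).1 hxv i
    rwa [dist_comm, Real.dist_eq] at this
  · exfalso
    obtain ⟨φ, u, hu, huv⟩ := geometric_hahn_banach_closed_point
      ((((convex_closedBall (0 : X) R).linear_image T.toLinearMap)).closure) isClosed_closure hv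
    let h : StrongDual ℝ X := φ.comp T
    have hle : ∀ x : X, ‖x‖ ≤ R → h x < u := fun x hx =>
      hu _ (subset_closure ⟨x, by simpa using hx, rfl⟩)
    have hu0 : 0 < u := by simpa using hle 0 (by simpa using hR0.le)
    have hsum : h = ∑ i, φ (fun j => if i = j then 1 else 0) • g i := by
      ext x
      have := LinearMap.pi_apply_eq_sum_univ φ.toLinearMap (T x)
      simpa [h, T, mul_comm] using this
    have hF : F h = φ v := by
      have := LinearMap.pi_apply_eq_sum_univ φ.toLinearMap v
      rw [hsum]
      simpa [v, mul_comm] using this.symm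
    have hnorm : ‖h‖ ≤ u / R := by
      refine h.opNorm_le_bound (by positivity) fun x => ?_
      rcases eq_or_ne x 0 with rfl | hx
      · simp
      have hx' : 0 < ‖x‖ := norm_pos_iff.2 hx
      have hn : ‖(R / ‖x‖) • x‖ ≤ R := by
        rw [norm_smul, Real.norm_of_nonneg (by positivity)]
        field_simp
        exact le_rfl
      have h1 := hle _ hn
      have h2 := hle (-((R / ‖x‖) • x)) (by rwa [norm_neg])
      rw [map_neg, map_smul, smul_eq_mul] at h2
      rw [map_smul, smul_eq_mul] at h1
      have h3 : R / ‖x‖ * |h x| ≤ u := by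
        rcases abs_cases (h x) with ⟨e, -⟩ | ⟨e, -⟩ <;> rw [e] <;> linarith
      rw [Real.norm_eq_abs, div_mul_eq_mul_div, le_div_iff₀ hR0]
      rw [div_mul_eq_mul_div, div_le_iff₀ hx'] at h3
      linarith
    have h4 : F h ≤ ‖F‖ * (u / R) :=
      (le_abs_self _).trans ((F.le_opNorm h).trans (by gcongr))
    have h5 : ‖F‖ * (u / R) < u := by
      rw [mul_div_assoc', div_lt_iff₀ hR0]
      nlinarith
    linarith

/-- If `F` has distance more than `d` from the canonical image of `X`, then it takes a value
larger than `d` at a functional of norm at most one that vanishes at given finitely many points. -/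
theorem exists_functional_vanishing_on_finset (F : StrongDual ℝ (StrongDual ℝ X)) {d : ℝ}
    (hd : 0 < d) (hF : ∀ x : X, d < ‖F - inclusionInDoubleDual ℝ X x‖) (s : Finset X) :
    ∃ g : StrongDual ℝ X, ‖g‖ ≤ 1 ∧ (∀ x ∈ s, g x = 0) ∧ d < F g := by
  let N : Submodule ℝ (StrongDual ℝ X) :=
    ⨅ x : s, LinearMap.ker (inclusionInDoubleDual ℝ X x).toLinearMap
  -- `F - G` vanishes on `N`, hence is evaluation at a combination of points of `s`; so `‖G‖`, the
  -- norm of `F` on `N`, exceeds `d`.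
  obtain ⟨G, hG, hGn⟩ := _root_.exists_extension_norm_eq N (F.comp N.subtypeL)
  have hspan : (F - G).toLinearMap ∈ Submodule.span ℝ
      (Set.range fun x : s => (inclusionInDoubleDual ℝ X x).toLinearMap) := by
    refine mem_span_of_iInf_ker_le_ker fun g hg => ?_
    have := hG ⟨g, hg⟩
    simpa [sub_eq_zero] using this.symm
  obtain ⟨c, hc⟩ := (Submodule.mem_span_range_iff_exists_fun ℝ).1 hspan
  have hGd : d < ‖G‖ := by
    convert hF (∑ x : s, c x • (x : X)) using 2
    ext g
    have := LinearMap.congr_fun hc g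
    simp [LinearMap.sum_apply] at this
    simp [this]
  by_contra! hcon
  refine absurd hGd (not_lt.2 ?_)
  rw [hGn]
  refine ContinuousLinearMap.opNorm_le_of_unit_norm hd.le fun g hg => ?_
  have hgN : ∀ x ∈ s, (g : StrongDual ℝ X) x = 0 := fun x hx => by
    have := (Submodule.mem_iInf _).1 g.2 ⟨x, hx⟩
    simpa using this
  have hg1 : ‖(g : StrongDual ℝ X)‖ ≤ 1 := hg.le
  have h1 := hcon g hg1 hgN
  have h2 := hcon (-g) (by rwa [norm_neg]) (fun x hx => by simp [hgN x hx])
  rw [map_neg] at h2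
  exact abs_le.2 ⟨by simpa using neg_le.1 h2, h1⟩

/-- A nonreflexive Banach space contains a bounded sequence that is triangular with respect to a
bounded sequence of functionals. -/
theorem exists_triangular_seq_of_not_isReflexiveSpace [CompleteSpace X]
    (hX : ¬ IsReflexiveSpace X) :
    ∃ (x : ℕ → X) (g : ℕ → StrongDual ℝ X) (R θ : ℝ), 0 < R ∧ 0 < θ ∧
      (∀ n, ‖x n‖ ≤ R) ∧ (∀ n, ‖g n‖ ≤ 1) ∧
      (∀ n k, n ≤ k → θ ≤ g n (x k)) ∧ ∀ n k, k < n → g n (x k) = 0 := by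
  classical
  obtain ⟨F, hF⟩ : ∃ F, ∀ x, inclusionInDoubleDual ℝ X x ≠ F := by
    simpa [IsReflexiveSpace, Function.Surjective] using hX
  have hclosed : IsClosed (Set.range (inclusionInDoubleDual ℝ X)) := by
    have h : Isometry (inclusionInDoubleDual ℝ X) := (inclusionInDoubleDualLi ℝ).isometry
    exact h.isClosedEmbedding.isClosed_range
  obtain ⟨r, hr, hball⟩ := Metric.isOpen_iff.1 hclosed.isOpen_compl F
    (by rintro ⟨x, hx⟩; exact hF x hx)
  have hdist : ∀ x : X, r / 2 < ‖F - inclusionInDoubleDual ℝ X x‖ := fun x => by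
    by_contra! hx
    refine hball (a := inclusionInDoubleDual ℝ X x) ?_ ⟨x, rfl⟩
    rw [mem_ball']
    exact (dist_eq_norm F _).trans_lt (hx.trans_lt (half_lt_self hr))
  -- The new `g` kills all earlier points; the new `x` then imitates `F` on `g` and all earlier
  -- functionals up to `r / 4`. Keeping `r / 2 < F p.2` leaves a value of at least `r / 4`.
  obtain ⟨p, hp, hpr⟩ := exists_seq_of_forall_finset_exists
    (fun p : X × StrongDual ℝ X => ‖p.1‖ ≤ ‖F‖ + 1 ∧ ‖p.2‖ ≤ 1 ∧ r / 4 ≤ p.2 p.1 ∧ r / 2 < F p.2)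
    (fun p q => q.2 p.1 = 0 ∧ r / 4 ≤ p.2 q.1) (fun s hs => by
      obtain ⟨g, hg1, hg0, hFg⟩ := exists_functional_vanishing_on_finset F (half_pos hr) hdist
        (s.image Prod.fst)
      obtain ⟨x, hx, hgx⟩ := exists_norm_le_forall_abs_sub_lt F
        (fun i : (insert g (s.image Prod.snd) : Finset (StrongDual ℝ X)) => i.1)
        (show 0 < r / 4 by positivity)
      refine ⟨(x, g), ⟨hx, hg1, ?_, hFg⟩, fun p hp => ⟨?_, ?_⟩⟩
      · have := (abs_lt.1 (hgx ⟨g, by simp⟩)).1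
        dsimp only at this ⊢
        linarith
      · exact hg0 _ (Finset.mem_image_of_mem _ hp)
      · have := (abs_lt.1 (hgx ⟨p.2,
          Finset.mem_insert_of_mem (Finset.mem_image_of_mem _ hp)⟩)).1
        have := (hs p hp).2.2.2
        dsimp only at *
        linarith)
  refine ⟨fun n => (p n).1, fun n => (p n).2, ‖F‖ + 1, r / 4, by positivity, by positivity,
    fun n => (hp n).1, fun n => (hp n).2.1, fun n k hnk => ?_, fun n k hkn => (hpr k n hkn).1⟩
  rcases hnk.eq_or_lt with rfl | h
  · exact (hp n).2.2.1
  · exact (hpr n k h).2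

end Bidual

/-! ### Nested convex sets in a nonreflexive space -/

section Sequences

variable {X : Type*} [NormedAddCommGroup X] [NormedSpace ℝ X]

theorem exists_antitone_seq_of_not_isReflexiveSpace [CompleteSpace X]
    (hX : ¬ IsReflexiveSpace X) :
    ∃ C : ℕ → Set X, Antitone C ∧
      (∀ n, Bornology.IsBounded (C n) ∧ IsClosed (C n) ∧ Convex ℝ (C n)) ∧
      (⋂ n, C n) = ∅ ∧
      ∀ ε : ℝ, 0 < ε → (⋂ n, (C n + ε • closedBall (0 : X) 1)).Nonempty := by
  obtain ⟨x, g, R, θ, hR, hθ, hx, hg, hpos, hzero⟩ :=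
    exists_triangular_seq_of_not_isReflexiveSpace hX
  let y : ℕ → ℕ → X := fun j k => x j + ((j : ℝ) + 1)⁻¹ • x k
  let S : ℕ → Set X := fun n => {z | ∃ j k, n ≤ k ∧ y j k = z}
  have hinv : ∀ j : ℕ, ((j : ℝ) + 1)⁻¹ ≤ 1 := fun j =>
    inv_le_one_of_one_le₀ (by linarith [j.cast_nonneg (α := ℝ)])
  have hgnn : ∀ n k, 0 ≤ g n (x k) := fun n k => by
    rcases le_or_gt n k with h | h
    · exact hθ.le.trans (hpos n k h)
    · exact (hzero n k h).ge
  have hsub : ∀ n, S n ⊆ closedBall 0 (2 * R) := by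
    rintro n _ ⟨j, k, -, rfl⟩
    have h1 : ‖((j : ℝ) + 1)⁻¹ • x k‖ ≤ 1 * R := by
      rw [norm_smul, Real.norm_of_nonneg (by positivity)]
      exact mul_le_mul (hinv j) (hx k) (norm_nonneg _) zero_le_one
    simpa using (norm_add_le _ _).trans (by linarith [hx j])
  refine ⟨fun n => closedConvexHull ℝ (S n), fun m n hmn => ?_, fun n => ⟨?_, ?_, ?_⟩, ?_, ?_⟩
  · refine (closedConvexHull ℝ).monotone ?_
    rintro _ ⟨j, k, hk, rfl⟩
    exact ⟨j, k, hmn.trans hk, rfl⟩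
  · exact isBounded_closedBall.subset
      (closedConvexHull_min (hsub n) (convex_closedBall _ _) isClosed_closedBall)
  · exact isClosed_closedConvexHull
  · exact convex_closedConvexHull
  · rw [Set.eq_empty_iff_forall_notMem]
    intro z hz
    rw [Set.mem_iInter] at hz
    -- On a generator, `g M (x j)` suffices if `M ≤ j`; otherwise `(M + 1) / (j + 1) ≥ 1` and `g m
    -- (x k)` suffices.
    have hkey : ∀ M m : ℕ, M ≤ m → θ ≤ ((M : ℝ) + 1) * g m z + g M z := by
      intro M m hMm
      let φ : StrongDual ℝ X := ((M : ℝ) + 1) • g m + g M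
      have hsubset : closedConvexHull ℝ (S m) ⊆ {w | θ ≤ φ w} := by
        refine closedConvexHull_min ?_ (convex_halfSpace_ge φ.toLinearMap.isLinear θ)
          (isClosed_le continuous_const φ.continuous)
        rintro _ ⟨j, k, hk, rfl⟩
        have hφ : φ (y j k) = (M + 1) * (g m (x j) + (j + 1 : ℝ)⁻¹ * g m (x k))
            + (g M (x j) + (j + 1 : ℝ)⁻¹ * g M (x k)) := by
          simp [φ, y]
        change θ ≤ φ (y j k)
        rw [hφ]
        have hj0 : (0 : ℝ) ≤ (j + 1 : ℝ)⁻¹ := by positivity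
        have h1 := mul_nonneg hj0 (hgnn M k)
        have h2 := hgnn M j
        have h3 : (0 : ℝ) ≤ (M + 1) * g m (x j) := mul_nonneg (by positivity) (hgnn m j)
        have h4 := mul_nonneg hj0 (hgnn m k)
        rcases le_or_gt M j with hMj | hjM
        · have h5 : (0 : ℝ) ≤ (M + 1) * ((j + 1 : ℝ)⁻¹ * g m (x k)) :=
            mul_nonneg (by positivity) h4
          linarith [hpos M j hMj]
        · have h5 : (1 : ℝ) ≤ (M + 1) * (j + 1 : ℝ)⁻¹ := by
            rw [← div_eq_mul_inv, one_le_div (by positivity)]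
            have : (j : ℝ) ≤ M := by exact_mod_cast hjM.le
            linarith
          have h6 := mul_le_mul h5 (hpos m k hk) hθ.le (by positivity)
          linarith
      simpa [φ] using hsubset (hz m)
    -- True on generators by triangularity; equicontinuity passes it to the closed hull. With `hkey`
    -- it forces `θ ≤ g M z` for all `M`, a contradiction.
    have hlim : Tendsto (fun m => g m z) atTop (𝓝 0) := by
      have heq : Equicontinuous fun (m : ℕ) (w : X) => g m w :=
        (LipschitzWith.uniformEquicontinuous _ 1 fun m =>
          (g m).lipschitz.weaken (by exact_mod_cast hg m)).equicontinuous
      have hcl : IsClosed {w : X | Tendsto (fun m => g m w) atTop (𝓝 0)} :=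
        heq.isClosed_setOfPred_tendsto continuous_const
      have hconv : Convex ℝ {w : X | Tendsto (fun m => g m w) atTop (𝓝 0)} := by
        intro u hu v hv a b _ _ _
        simpa using (Tendsto.const_mul a hu).add (Tendsto.const_mul b hv)
      refine closedConvexHull_min ?_ hconv hcl (hz 0)
      rintro _ ⟨j, k, -, rfl⟩
      have hev : ∀ i, Tendsto (fun m => g m (x i)) atTop (𝓝 0) := fun i =>
        tendsto_const_nhds.congr' <| (eventually_gt_atTop i).mono fun m hm => (hzero m i hm).symm
      simpa [y] using (hev j).add ((hev k).const_mul ((j : ℝ) + 1)⁻¹)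
    have hM : ∀ M, θ ≤ g M z := fun M => by
      have h1 : Tendsto (fun m => ((M : ℝ) + 1) * g m z + g M z) atTop (𝓝 (g M z)) := by
        simpa using (hlim.const_mul ((M : ℝ) + 1)).add_const (g M z)
      exact ge_of_tendsto h1 ((eventually_ge_atTop M).mono fun m hm => hkey M m hm)
    exact absurd (ge_of_tendsto' hlim hM) (not_le.2 hθ)
  · intro ε hε
    obtain ⟨j, hj⟩ := exists_nat_gt (R / ε)
    refine ⟨x j, Set.mem_iInter.2 fun n => ?_⟩
    refine Set.mem_add.2 ⟨y j n, subset_closedConvexHull ⟨j, n, le_rfl, rfl⟩,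
      -(((j : ℝ) + 1)⁻¹ • x n), ?_, by simp [y]⟩
    rw [_root_.smul_closedBall _ _ zero_le_one, smul_zero, Real.norm_of_nonneg hε.le, mul_one,
      mem_closedBall_zero_iff, norm_neg, norm_smul, Real.norm_of_nonneg (by positivity),
      inv_mul_le_iff₀ (by positivity)]
    rw [div_lt_iff₀ hε] at hj
    linarith [hx n]

end Sequences

/-! ### Reciprocals of convex functions and convex majorants -/

section Reciprocal

variable {X : Type*} [NormedAddCommGroup X] [NormedSpace ℝ X]

/-- Midpoint convexity at `x` and `-x` gives `-g₂ x ≤ g₂ (-x) - 2 * g₂ 0`. -/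
theorem IsDCFunction.exists_convex_majorant {h : X → ℝ} (hh : IsDCFunction h) :
    ∃ k : X → ℝ, Continuous k ∧ ConvexOn ℝ Set.univ k ∧ ∀ x, h x ≤ k x := by
  obtain ⟨g₁, g₂, hc₁, hv₁, hc₂, hv₂, hg⟩ := hh
  refine ⟨fun x => g₁ x + g₂ (-x) - 2 * g₂ 0, by fun_prop, ?_, fun x => ?_⟩
  · have h2 : ConvexOn ℝ Set.univ fun x => g₂ (-x) :=
      hv₂.comp_linearMap (-LinearMap.id)
    simp only [sub_eq_add_neg]
    exact (hv₁.add h2).add_const (-(2 * g₂ 0))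
  · have := hv₂.2 (Set.mem_univ x) (Set.mem_univ (-x)) (by norm_num : (0 : ℝ) ≤ 1 / 2)
      (by norm_num : (0 : ℝ) ≤ 1 / 2) (by norm_num)
    simp only [smul_neg, add_neg_cancel, smul_eq_mul] at this
    rw [hg x]
    linarith

/-- The reciprocal of a positive continuous convex function `f` is d.c. as soon as `1 / f ^ 2` has
a continuous convex majorant. -/
theorem isDCFunction_one_div_of_majorant {f k : X → ℝ} (hf : Continuous f)
    (hfc : ConvexOn ℝ Set.univ f) (hpos : ∀ x, 0 < f x) (hk : Continuous k)
    (hkc : ConvexOn ℝ Set.univ k) (hfk : ∀ x, 1 / f x ^ 2 ≤ k x) :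
    IsDCFunction fun x => 1 / f x := by
  have hk0 : ∀ x, 0 ≤ k x := fun x => le_trans (by positivity) (hfk x)
  have hsq : ConvexOn ℝ Set.univ fun x => (f x + k x) ^ 2 :=
    (hfc.add hkc).pow (fun x _ => add_nonneg (hpos x).le (hk0 x)) 2
  refine ⟨fun x => 1 / f x + (f x + k x) ^ 2, fun x => (f x + k x) ^ 2, ?_, ?_, by fun_prop,
    hsq, fun x => by ring⟩
  · exact (continuous_const.div hf fun x => (hpos x).ne').add (by fun_prop)
  refine ⟨convex_univ, fun x _ y _ a b ha hb hab => ?_⟩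
  set z := a • x + b • y
  have ht := hfc.2 (Set.mem_univ x) (Set.mem_univ y) ha hb hab
  have hs := hkc.2 (Set.mem_univ x) (Set.mem_univ y) ha hb hab
  simp only [smul_eq_mul] at ht hs ⊢
  set T := a * f x + b * f y
  set S := a * k x + b * k y
  have ht0 : 0 < f z := hpos z
  have hT0 : 0 < T := ht0.trans_le ht
  have hinv : 1 / T ≤ a * (1 / f x) + b * (1 / f y) := by
    have := (convexOn_zpow (𝕜 := ℝ) (-1)).2 (hpos x) (hpos y) ha hb hab
    simpa using this
  have hsquare : (T + S) ^ 2 ≤ a * (f x + k x) ^ 2 + b * (f y + k y) ^ 2 := by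
    have := (convexOn_pow 2 (𝕜 := ℝ)).2
      (add_nonneg (hpos x).le (hk0 x)) (add_nonneg (hpos y).le (hk0 y)) ha hb hab
    simp only [smul_eq_mul] at this
    have hTS : T + S = a * (f x + k x) + b * (f y + k y) := by
      simp only [T, S]
      ring
    rwa [hTS]
  -- Raising `f z` to `T` lowers the reciprocal by at most `(T - f z) * k z`, which the growth of
  -- the square absorbs.
  have hmono : 1 / f z + (f z + k z) ^ 2 ≤ 1 / T + (T + S) ^ 2 := by
    have h1 : 1 / f z - 1 / T ≤ (T - f z) * (1 / f z ^ 2) := by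
      have : 1 / f z - 1 / T = (T - f z) * (1 / (f z * T)) := by field_simp
      rw [this]
      refine mul_le_mul_of_nonneg_left (one_div_le_one_div_of_le (by positivity) ?_) (by linarith)
      rw [sq]
      exact mul_le_mul_of_nonneg_left ht ht0.le
    have h2 : (T - f z) * (1 / f z ^ 2) ≤ (T - f z) * k z :=
      mul_le_mul_of_nonneg_left (hfk z) (by linarith)
    have h3 : (f z + k z) ^ 2 + (T - f z) * k z ≤ (T + S) ^ 2 := by
      have h4 : (T + k z) ^ 2 ≤ (T + S) ^ 2 :=
        pow_le_pow_left₀ (add_nonneg hT0.le (hk0 z)) (by linarith) 2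
      have h5 : 0 ≤ (T - f z) * k z := mul_nonneg (by linarith) (hk0 z)
      have h6 : 0 ≤ (T - f z) * (T + f z) := mul_nonneg (by linarith) (by linarith)
      linarith
    linarith
  linarith

/-- A function that is bounded above on every ball has a continuous convex majorant. -/
theorem exists_convex_majorant_of_bddAbove_closedBall {h : X → ℝ}
    (hh : ∀ n : ℕ, ∃ M, ∀ x : X, ‖x‖ ≤ n → h x ≤ M) :
    ∃ k : X → ℝ, Continuous k ∧ ConvexOn ℝ Set.univ k ∧ ∀ x, h x ≤ k x := by
  choose M hM using hh
  -- The `n`-th hinge is at least `1` on the shell `n + 1 < ‖x‖ ≤ n + 2`, where `M (n + 2)` bounds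
  -- `h`; `M 1` serves the unit ball.
  let s : ℕ → X → ℝ := fun N x =>
    |M 1| + ∑ n ∈ Finset.range N, |M (n + 2)| * max 0 (‖x‖ - n)
  let k : X → ℝ := fun x => s ⌈‖x‖⌉₊ x
  have hks : ∀ (N : ℕ) (x : X), ‖x‖ ≤ N → k x = s N x := fun N x hx => by
    refine congrArg (|M 1| + ·) (Finset.sum_subset
      (Finset.range_mono (Nat.ceil_le.2 hx)) fun n _ hn => ?_)
    have : ‖x‖ ≤ n := Nat.ceil_le.1 (by simpa using hn)
    rw [max_eq_left (by linarith), mul_zero]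
  have hscont : ∀ N, Continuous (s N) := fun N => by fun_prop
  have hsconv : ∀ N, ConvexOn ℝ Set.univ (s N) := fun N => by
    refine (convexOn_const _ convex_univ).add ?_
    induction N with
    | zero => simpa using convexOn_const (0 : ℝ) (convex_univ (𝕜 := ℝ) (E := X))
    | succ N ih =>
      simp only [Finset.sum_range_succ]
      refine ih.add (ConvexOn.smul (abs_nonneg _) ?_)
      refine (convexOn_const _ convex_univ).sup ?_
      simp only [sub_eq_add_neg]
      exact (convexOn_norm convex_univ).add_const (-(N : ℝ))
  refine ⟨k, continuous_iff_continuousAt.2 fun x => ?_, ⟨convex_univ,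
    fun x _ y _ a b ha hb hab => ?_⟩, fun x => ?_⟩
  · obtain ⟨N, hN⟩ := exists_nat_gt ‖x‖
    refine (hscont N).continuousAt.congr ?_
    filter_upwards [continuous_norm.continuousAt.eventually_lt continuousAt_const hN] with y hy
    exact (hks N y hy.le).symm
  · obtain ⟨N, hN⟩ := exists_nat_ge (max ‖x‖ ‖y‖)
    have hx := (le_max_left _ _).trans hN
    have hy := (le_max_right _ _).trans hN
    have hz : ‖a • x + b • y‖ ≤ N := by
      have := convex_closedBall (0 : X) N (by simpa using hx) (by simpa using hy) ha hb hab
      simpa using this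
    rw [hks N _ hx, hks N _ hy, hks N _ hz]
    exact (hsconv N).2 (Set.mem_univ x) (Set.mem_univ y) ha hb hab
  · have hterm : ∀ n ∈ Finset.range ⌈‖x‖⌉₊, 0 ≤ |M (n + 2)| * max 0 (‖x‖ - n) := fun n _ => by
      positivity
    rcases le_or_gt ‖x‖ 1 with h1 | h1
    · have := hM 1 x (by simpa using h1)
      have h2 := Finset.sum_nonneg hterm
      calc h x ≤ |M 1| := this.trans (le_abs_self _)
        _ ≤ k x := le_add_of_nonneg_right h2
    · obtain ⟨n, hn⟩ : ∃ n : ℕ, ⌈‖x‖⌉₊ = n + 2 :=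
        ⟨⌈‖x‖⌉₊ - 2, by have := Nat.lt_ceil.2 (show ((1 : ℕ) : ℝ) < ‖x‖ by simpa using h1); omega⟩
      have hle : ‖x‖ ≤ (n + 2 : ℕ) := hn ▸ Nat.le_ceil _
      have hlt : ((n + 1 : ℕ) : ℝ) < ‖x‖ := Nat.lt_ceil.1 (by omega)
      push_cast at hlt
      have h2 := Finset.single_le_sum hterm (Finset.mem_range.2 (show n < ⌈‖x‖⌉₊ by omega))
      calc h x ≤ |M (n + 2)| := (hM _ x hle).trans (le_abs_self _)
        _ ≤ |M (n + 2)| * max 0 (‖x‖ - n) :=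
          le_mul_of_one_le_right (abs_nonneg _) (le_max_of_le_right (by linarith))
        _ ≤ k x := h2.trans (le_add_of_nonneg_left (abs_nonneg _))

theorem IsReflexiveSpace.isDCFunction_one_div (hX : IsReflexiveSpace X) {f : X → ℝ}
    (hf : Continuous f) (hfc : ConvexOn ℝ Set.univ f) (hpos : ∀ x, 0 < f x) :
    IsDCFunction fun x => 1 / f x := by
  obtain ⟨k, hk, hkc, hfk⟩ := exists_convex_majorant_of_bddAbove_closedBall
    (h := fun x => 1 / f x ^ 2) fun r => by
      by_contra! hcon
      -- A common point of these sets would have `f x ≤ 0`.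
      let C : ℕ → Set X := fun n => closedBall 0 r ∩ {x | f x ≤ 1 / ((n : ℝ) + 1)}
      obtain ⟨x, hx⟩ := hX.nonempty_iInter (C := C)
        (fun m n hmn x hx => ⟨hx.1, hx.2.out.trans (Nat.one_div_le_one_div hmn)⟩)
        (fun n => by
          obtain ⟨x, hxr, hx⟩ := hcon (((n : ℝ) + 1) ^ 2)
          refine ⟨x, by simpa using hxr, ?_⟩
          have h0 := hpos x
          rw [← one_div_pow] at hx
          have h1 := lt_of_pow_lt_pow_left₀ 2 (by positivity) hx
          exact ((lt_one_div (by positivity) h0).1 h1).le)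
        (fun n => isBounded_closedBall.subset Set.inter_subset_left)
        (fun n => isClosed_closedBall.inter (isClosed_le hf continuous_const))
        (fun n => (convex_closedBall _ _).inter (by simpa using hfc.convex_le (1 / ((n : ℝ) + 1))))
      rw [Set.mem_iInter] at hx
      obtain ⟨n, hn⟩ := exists_nat_one_div_lt (hpos x)
      exact absurd (hx n).2 (not_le.2 hn)
  exact isDCFunction_one_div_of_majorant hf hfc hpos hk hkc hfk

theorem Convex.convexOn_infDist {C : Set X} (hC : Convex ℝ C) (hne : C.Nonempty) :
    ConvexOn ℝ Set.univ fun x => infDist x C := by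
  refine ⟨convex_univ, fun x _ y _ a b ha hb hab => le_of_forall_pos_le_add fun ε hε => ?_⟩
  obtain ⟨u, hu, hxu⟩ := (infDist_lt_iff hne).1 (lt_add_of_pos_right (infDist x C) hε)
  obtain ⟨v, hv, hyv⟩ := (infDist_lt_iff hne).1 (lt_add_of_pos_right (infDist y C) hε)
  calc infDist (a • x + b • y) C ≤ dist (a • x + b • y) (a • u + b • v) :=
        infDist_le_dist_of_mem (hC hu hv ha hb hab)
    _ ≤ dist (a • x) (a • u) + dist (b • y) (b • v) := dist_add_add_le _ _ _ _
    _ = a * dist x u + b * dist y v := by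
        simp only [dist_smul₀, Real.norm_of_nonneg ha, Real.norm_of_nonneg hb]
    _ ≤ a * (infDist x C + ε) + b * (infDist y C + ε) := by gcongr
    _ = a • infDist x C + b • infDist y C + ε := by
        simp only [smul_eq_mul]
        linear_combination ε * hab

/-- A convex function that is bounded near the origin is bounded on all balls of a fixed radius. -/
theorem ConvexOn.exists_le_on_closedBall {k : X → ℝ} (hkc : ConvexOn ℝ Set.univ k)
    (hk : ContinuousAt k 0) :
    ∃ ε : ℝ, 0 < ε ∧ ∀ p : X, ∃ M, ∀ y ∈ closedBall p ε, k y ≤ M := by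
  obtain ⟨δ, hδ, hball⟩ := Metric.eventually_nhds_iff_ball.1
    (hk.eventually_lt continuousAt_const (lt_add_one (k 0)))
  -- `y` is the midpoint of `2 • p` and `2 • (y - p)`, the latter of norm at most `δ / 2`.
  refine ⟨δ / 4, by positivity, fun p => ⟨max (k ((2 : ℝ) • p)) (k 0 + 1), fun y hy => ?_⟩⟩
  have h1 : k ((2 : ℝ) • (y - p)) < k 0 + 1 := by
    refine hball _ ?_
    rw [mem_closedBall, dist_eq_norm] at hy
    rw [mem_ball_zero_iff, norm_smul, Real.norm_of_nonneg zero_le_two]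
    linarith
  have h2 := hkc.le_max_of_mem_segment (Set.mem_univ ((2 : ℝ) • p))
    (Set.mem_univ ((2 : ℝ) • (y - p))) (z := y)
    ⟨1 / 2, 1 / 2, by norm_num, by norm_num, by norm_num, by module⟩
  exact h2.trans (max_le_max le_rfl h1.le)

theorem exists_not_isDCFunction_one_div {C : ℕ → Set X} (hanti : Antitone C)
    (hC : ∀ n, Bornology.IsBounded (C n) ∧ IsClosed (C n) ∧ Convex ℝ (C n))
    (hempty : (⋂ n, C n) = ∅)
    (hε : ∀ ε : ℝ, 0 < ε → (⋂ n, (C n + ε • closedBall (0 : X) 1)).Nonempty) :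
    ∃ f : X → ℝ, Continuous f ∧ ConvexOn ℝ Set.univ f ∧ (∀ x, 0 < f x) ∧
      ¬ IsDCFunction (fun x => 1 / f x) := by
  have hne : ∀ n, (C n).Nonempty := fun n => by
    obtain ⟨p, hp⟩ := hε 1 one_pos
    obtain ⟨y, hy, -⟩ := Set.mem_add.1 (Set.mem_iInter.1 hp n)
    exact ⟨y, hy⟩
  obtain ⟨R, hR0, hR⟩ := (hC 0).1.subset_closedBall_lt 0 0
  have hnorm : ∀ n, ∀ y ∈ C n, ‖y‖ ≤ R := fun n y hy => by
    simpa using hR (hanti n.zero_le hy)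
  have hdist : ∀ n x, infDist x (C n) ≤ ‖x‖ + R := fun n x => by
    obtain ⟨y, hy⟩ := hne n
    exact (infDist_le_dist_of_mem hy).trans
      ((dist_eq_norm x y).trans_le ((norm_sub_le _ _).trans (by linarith [hnorm n y hy])))
  let d : ℕ → X → ℝ := fun n x => infDist x (C n) / ((n : ℝ) + 1)
  have hd_le : ∀ n x, d n x ≤ infDist x (C n) := fun n x =>
    div_le_self infDist_nonneg (by linarith [n.cast_nonneg (α := ℝ)])
  have hbdd : ∀ x, BddAbove (Set.range fun n => d n x) := fun x => by
    refine ⟨‖x‖ + R, ?_⟩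
    rintro _ ⟨n, rfl⟩
    exact (hd_le n x).trans (hdist n x)
  let f : X → ℝ := fun x => ⨆ n, d n x
  have hle : ∀ n x, d n x ≤ f x := fun n x => le_ciSup (hbdd x) n
  -- Terms with `m ≤ n` vanish on `C n`; the weights make the later ones small.
  have hfC : ∀ n, ∀ y ∈ C n, f y ≤ 2 * R / ((n : ℝ) + 1) := fun n y hy => by
    refine ciSup_le fun m => ?_
    rcases le_or_gt m n with hmn | hnm
    · simp only [d, infDist_zero_of_mem (hanti hmn hy), zero_div]
      positivity
    · have h1 : infDist y (C m) ≤ 2 * R := (hdist m y).trans (by linarith [hnorm n y hy])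
      have h2 : (n : ℝ) ≤ m := by exact_mod_cast hnm.le
      exact div_le_div₀ (by positivity) h1 (by positivity) (by linarith)
  have hpos : ∀ x, 0 < f x := fun x => by
    obtain ⟨n, hn⟩ : ∃ n, x ∉ C n := by
      by_contra! h
      exact (Set.eq_empty_iff_forall_notMem.1 hempty x) (Set.mem_iInter.2 h)
    have h1 := ((hC n).2.1.notMem_iff_infDist_pos (hne n)).1 hn
    exact lt_of_lt_of_le (by simp only [d]; positivity) (hle n x)
  refine ⟨f, ?_, ⟨convex_univ, fun x _ y _ a b ha hb hab => ciSup_le fun n => ?_⟩, hpos,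
    fun hdc => ?_⟩
  · refine (LipschitzWith.of_le_add fun x y => ciSup_le fun n => ?_).continuous
    have h1 : d n x ≤ d n y + dist x y / ((n : ℝ) + 1) := by
      simp only [d, ← add_div]
      gcongr
      exact infDist_le_infDist_add_dist
    have h2 : dist x y / ((n : ℝ) + 1) ≤ dist x y :=
      div_le_self dist_nonneg (by linarith [n.cast_nonneg (α := ℝ)])
    linarith [hle n y]
  · have h1 := ((hC n).2.2.convexOn_infDist (hne n)).2 (Set.mem_univ x) (Set.mem_univ y) ha hb hab
    simp only [smul_eq_mul] at h1 ⊢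
    calc d n (a • x + b • y) ≤ (a * infDist x (C n) + b * infDist y (C n)) / ((n : ℝ) + 1) := by
          simp only [d]
          gcongr
      _ = a * d n x + b * d n y := by simp only [d]; ring
      _ ≤ a * f x + b * f y := by
          gcongr
          exacts [hle n x, hle n y]
  · obtain ⟨k, hk, hkc, hfk⟩ := hdc.exists_convex_majorant
    obtain ⟨ε, hε0, hbound⟩ := hkc.exists_le_on_closedBall hk.continuousAt
    obtain ⟨p, hp⟩ := hε ε hε0
    obtain ⟨M, hM⟩ := hbound p
    obtain ⟨n, hn⟩ := exists_nat_gt (M * (2 * R))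
    obtain ⟨y, hy, e, he, hye⟩ := Set.mem_add.1 (Set.mem_iInter.1 hp n)
    rw [_root_.smul_closedBall _ _ zero_le_one, smul_zero, Real.norm_of_nonneg hε0.le, mul_one,
      mem_closedBall_zero_iff] at he
    have h1 : k y ≤ M := hM y (by
      rw [mem_closedBall', dist_eq_norm, ← hye, add_sub_cancel_left]
      exact he)
    have h2 : ((n : ℝ) + 1) / (2 * R) ≤ 1 / f y := by
      rw [← one_div_div]
      exact one_div_le_one_div_of_le (hpos y) (hfC n y hy)
    have h3 := h2.trans ((hfk y).trans h1)
    rw [div_le_iff₀ (by positivity)] at h3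
    linarith

end Reciprocal

theorem theorem4 (X : Type*) [NormedAddCommGroup X] [NormedSpace ℝ X] [CompleteSpace X] :
    List.TFAE
      [ ¬ IsReflexiveSpace X,
        ∃ f : X → ℝ, Continuous f ∧ ConvexOn ℝ Set.univ f ∧ (∀ x, 0 < f x) ∧
          ¬ IsDCFunction (fun x => 1 / f x),
        ∃ C : ℕ → Set X, Antitone C ∧
          (∀ n, Bornology.IsBounded (C n) ∧ IsClosed (C n) ∧ Convex ℝ (C n)) ∧
          (⋂ n, C n) = ∅ ∧
          ∀ ε : ℝ, 0 < ε → (⋂ n, (C n + ε • Metric.closedBall (0 : X) 1)).Nonempty ] := by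
  tfae_have 1 → 3 := exists_antitone_seq_of_not_isReflexiveSpace
  tfae_have 3 → 2 := fun ⟨_, hanti, hC, hempty, hε⟩ =>
    exists_not_isDCFunction_one_div hanti hC hempty hε
  tfae_have 2 → 1 := fun ⟨_, hf, hfc, hpos, hndc⟩ hX =>
    hndc (hX.isDCFunction_one_div hf hfc hpos)
  tfae_finish
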